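/- Let $m>d\ge 0$ be integers, $[m]=\{1,\dots,m\}$, and let $A=(A_1,\dots,A_m)$ be an $m$-tuple of vectors in $\mathbb R^d$. For $I\subset[m]$ let $\mathrm{conv}\,A(I)$ denote the convex hull of the vectors $A_i$ with $i\in I$. Suppose that $A$ is admissible, that is, (1) $0\in\mathrm{conv}\,A([m])$, and (2) for every $I\subset[m]$, if $0\in\mathrm{conv}\,A(I)$ then $I$ has more than $d$ elements. Suppose moreover that $A$ is centered at the origin, that is, $\sum_{i=1}^m A_i=0$. Put $$\mathcal S_A=\{z\in\mathbb C^m \mid 0\in \mathrm{conv}\,A(I_z)\},\quad I_z=\{i\in[m]\mid z_i\neq 0\},\qquad K_A=\{\sigma\subset[m]\mid 0\in\mathrm{conv}\,A([m]\setminus\sigma)\},$$ and $$(D^2,S^1)^{K_A}=\bigcup_{\sigma\in K_A}\{y\in\mathbb C^m \mid |y_i|\le 1 \text{ for } i\in\sigma,\ |y_i|=1\text{ for } i\notin\sigma\}.$$ Then for every $z\in\mathcal S_A$ there is a unique pair $(r,T)\in\mathbb R_{>0}\times\mathbb R^d$ such that $$r\,\bigl(z_i e^{\langle A_i,T\rangle}\bigr)_{i=1}^m\in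 (D^2,S^1)^{K_A}.$$ -/

import Mathlib

namespace SiegelLeaf

/-- The convex hull `conv A(I)` of the subtuple of `A` indexed by `I`. -/
def convSub {m d : ℕ} (A : Fin m → EuclideanSpace ℝ (Fin d)) (I : Finset (Fin m)) :
    Set (EuclideanSpace ℝ (Fin d)) :=
  convexHull ℝ (A '' (I : Set (Fin m)))

/-- Admissible tuples: the Siegel condition and the weak hyperbolicity condition. -/
structure IsAdmissible {m d : ℕ} (A : Fin m → EuclideanSpace ℝ (Fin d)) : Prop where
  siegel : (0 : EuclideanSpace ℝ (Fin d)) ∈ convexHull ℝ (Set.range A)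
  weaklyHyperbolic : ∀ I : Finset (Fin m),
    (0 : EuclideanSpace ℝ (Fin d)) ∈ convSub A I → d < I.card

/-- The centroid of the tuple is the origin. -/
def IsCentered {m d : ℕ} (A : Fin m → EuclideanSpace ℝ (Fin d)) : Prop :=
  ∑ i, A i = 0

/-- The set `I_z` of indices of the non-zero entries of `z`. -/
noncomputable def nonzeroIndices {m : ℕ} (z : Fin m → ℂ) : Finset (Fin m) :=
  letI := Classical.decPred fun i : Fin m => z i ≠ 0
  Finset.univ.filter fun i => z i ≠ 0

/-- `S_A`, the union of all Siegel leaves. -/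
def siegelSet {m d : ℕ} (A : Fin m → EuclideanSpace ℝ (Fin d)) : Set (Fin m → ℂ) :=
  {z | (0 : EuclideanSpace ℝ (Fin d)) ∈ convSub A (nonzeroIndices z)}

/-- The simplicial complex `K_A` (the empty simplex is allowed). -/
def simplicialComplex {m d : ℕ} (A : Fin m → EuclideanSpace ℝ (Fin d)) :
    Set (Finset (Fin m)) :=
  {σ | (0 : EuclideanSpace ℝ (Fin d)) ∈ convSub A σᶜ}

/-- The moment-angle complex `(D², S¹)^K`, a union of products of closed unit discs (over the
indices in a simplex) and unit circles (over the other indices). -/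
def momentAngleComplex {m : ℕ} (K : Set (Finset (Fin m))) : Set (Fin m → ℂ) :=
  ⋃ σ ∈ K, Set.univ.pi fun i =>
    if i ∈ σ then Metric.closedBall (0 : ℂ) 1 else Metric.sphere (0 : ℂ) 1

/-- The map `Φ_A(z, T, r) = r (z_i e^{⟨A_i, T⟩})_i`. -/
noncomputable def leafMap {m d : ℕ} (A : Fin m → EuclideanSpace ℝ (Fin d)) (z : Fin m → ℂ)
    (T : EuclideanSpace ℝ (Fin d)) (r : ℝ) : Fin m → ℂ :=
  fun i => (r : ℂ) * (z i * (Real.exp (inner ℝ (A i) T) : ℂ))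

end SiegelLeaf

/-!
Call an index `i` *active* for `(r, T)` if `r ‖z i‖ exp ⟪A i, T⟫ = 1`. The point `leafMap A z T r`
lies in the moment-angle complex exactly when all its entries have norm at most one and the origin
is in the convex hull of the `A i` with `i` active (`mem_momentAngleComplex_iff`). This is the
first-order condition for `T` to minimise the convex function `g T = max_i ‖z i‖ exp ⟪A i, T⟫`,
with `r = 1 / g T`.

Weak hyperbolicity enters through `IsAdmissible.eq_zero_of_inner_nonpos`: if `0 ∈ conv A(I)`, then
no nonzero `v` satisfies `⟪A i, v⟫ ≤ 0` for all `i ∈ I`. Indeed, by Carathéodory the origin is a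
positive combination of affinely independent `A i`; these would all be orthogonal to `v`, hence at
most `d` in number.

Existence: by this fact and compactness of the unit sphere, `g` is coercive, so it attains its
minimum. If the origin were not in the convex hull of the active vectors, a separating hyperplane
would give a direction along which `g` decreases. Uniqueness: if `(r, T)` and `(s, T')` both work
and `r ≤ s`, then `⟪A i, T' - T⟫ ≤ 0` for every `i` active for `(r, T)`, so `T' = T`.
-/

namespace SiegelLeaf

open Filter Topology

variable {m d : ℕ} {A : Fin m → EuclideanSpace ℝ (Fin d)} {z : Fin m → ℂ}

/-! ### Weak hyperbolicity -/

/-- Under weak hyperbolicity, a subtuple with the origin in its convex hull does not lie in any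
closed half-space bounded by a hyperplane through the origin. -/
theorem IsAdmissible.eq_zero_of_inner_nonpos (hA : IsAdmissible A) {I : Finset (Fin m)}
    (hI : 0 ∈ convSub A I) {v : EuclideanSpace ℝ (Fin d)}
    (hv : ∀ i ∈ I, inner ℝ (A i) v ≤ 0) : v = 0 := by
  classical
  by_contra hv0
  obtain ⟨ι, _, p, w, hp, hind, hw, hw1, hsum⟩ := eq_pos_convex_span_of_mem_convexHull hI
  have hk : ∀ j, ∃ i ∈ I, A i = p j := fun j => by simpa using hp (Set.mem_range_self j)
  choose k hkI hkp using hk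
  have hcard : d < Fintype.card ι := by
    have h0 : (0 : EuclideanSpace ℝ (Fin d)) ∈ convSub A (Finset.univ.image k) := by
      rw [← hsum]
      refine (convex_convexHull ℝ _).sum_mem (fun j _ => (hw j).le) hw1 fun j _ => ?_
      exact subset_convexHull ℝ _ ⟨k j, by simp, hkp j⟩
    exact (hA.weaklyHyperbolic _ h0).trans_le Finset.card_image_le
  have horth : ∀ j, inner ℝ (p j) v = 0 := by
    have hle : ∀ j ∈ Finset.univ, w j * inner ℝ (p j) v ≤ 0 := fun j _ =>
      mul_nonpos_of_nonneg_of_nonpos (hw j).le (hkp j ▸ hv _ (hkI j))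
    have hs : ∑ j, w j * inner ℝ (p j) v = 0 := by
      simpa [sum_inner, real_inner_smul_left] using congrArg (fun x => inner ℝ x v) hsum
    intro j
    have := (Finset.sum_eq_zero_iff_of_nonpos hle).1 hs j (Finset.mem_univ j)
    exact (mul_eq_zero.1 this).resolve_left (hw j).ne'
  have hspan : vectorSpan ℝ (Set.range p) ≤ (ℝ ∙ v)ᗮ := by
    rw [vectorSpan_def, Submodule.span_le]
    rintro _ ⟨_, ⟨i, rfl⟩, _, ⟨j, rfl⟩, rfl⟩
    simp [Submodule.mem_orthogonal_singleton_iff_inner_left, inner_sub_left, horth]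
  have hdim := Submodule.finrank_mono hspan
  have hperp := Submodule.finrank_add_finrank_orthogonal (ℝ ∙ v)
  rw [finrank_span_singleton hv0, finrank_euclideanSpace_fin] at hperp
  have : Nonempty ι := Fintype.card_pos_iff.1 (by omega)
  have := hind.finrank_vectorSpan_add_one
  omega

theorem nonempty_of_zero_mem_convSub {I : Finset (Fin m)} (hI : 0 ∈ convSub A I) :
    I.Nonempty := by
  have := convexHull_nonempty_iff.1 ⟨_, hI⟩
  simpa using this

/-- A quantitative form of `IsAdmissible.eq_zero_of_inner_nonpos`: the support function of the
subtuple is bounded below by a positive multiple of the norm. -/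
theorem IsAdmissible.exists_mul_norm_le_inner (hA : IsAdmissible A) {I : Finset (Fin m)}
    (hI : 0 ∈ convSub A I) :
    ∃ ε : ℝ, 0 < ε ∧ ∀ T, ∃ i ∈ I, ε * ‖T‖ ≤ inner ℝ (A i) T := by
  have hne := nonempty_of_zero_mem_convSub hI
  let h : EuclideanSpace ℝ (Fin d) → ℝ := fun T => I.sup' hne fun i => inner ℝ (A i) T
  have hcont : Continuous h := Continuous.finset_sup'_apply hne fun i _ => by fun_prop
  have hpos : ∀ T, T ≠ 0 → 0 < h T := by
    intro T hT
    by_contra! hle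
    exact hT (hA.eq_zero_of_inner_nonpos hI ((Finset.sup'_le_iff hne _).1 hle))
  obtain ⟨ε, hε, hmin⟩ : ∃ ε : ℝ, 0 < ε ∧ ∀ u, ‖u‖ = 1 → ε ≤ h u := by
    -- The sphere is empty when `d = 0`.
    rcases (Metric.sphere (0 : EuclideanSpace ℝ (Fin d)) 1).eq_empty_or_nonempty with he | hs
    · refine ⟨1, one_pos, fun u hu => ?_⟩
      exact absurd (by simpa using hu : u ∈ Metric.sphere 0 1) (by simp [he])
    · obtain ⟨u, hu, hmin⟩ := (isCompact_sphere _ _).exists_isMinOn hs hcont.continuousOn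
      refine ⟨h u, hpos u (ne_zero_of_mem_unit_sphere ⟨u, hu⟩), fun v hv => ?_⟩
      exact hmin (by simpa using hv)
  refine ⟨ε, hε, fun T => ?_⟩
  rcases eq_or_ne T 0 with rfl | hT
  · obtain ⟨i, hi⟩ := hne
    exact ⟨i, hi, by simp⟩
  have hT' : 0 < ‖T‖ := norm_pos_iff.2 hT
  obtain ⟨i, hi, hle⟩ := (Finset.le_sup'_iff hne).1 (hmin (‖T‖⁻¹ • T) (norm_smul_inv_norm hT))
  refine ⟨i, hi, ?_⟩
  rwa [real_inner_smul_right, inv_mul_eq_div, le_div_iff₀ hT'] at hle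

/-! ### Points of the moment-angle complex -/

/-- The complement of a simplex of `K_A` stays such a complement when it is enlarged, so it is enough
to test the set of all indices at which `y` has norm one. -/
theorem mem_momentAngleComplex_iff {y : Fin m → ℂ} :
    y ∈ momentAngleComplex (simplicialComplex A) ↔
      (∀ i, ‖y i‖ ≤ 1) ∧ 0 ∈ convSub A (Finset.univ.filter fun i => ‖y i‖ = 1) := by
  simp only [momentAngleComplex, simplicialComplex, Set.mem_iUnion, Set.mem_pi, Set.mem_univ,
    true_imp_iff, exists_prop, Set.mem_ofPred_eq]
  constructor
  · rintro ⟨σ, hσ, hy⟩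
    refine ⟨fun i => ?_, convexHull_mono (Set.image_mono fun i hi => ?_) hσ⟩
    · have := hy i
      split_ifs at this
      · simpa using this
      · exact (mem_sphere_zero_iff_norm.1 this).le
    · have := hy i
      rw [if_neg (by simpa using hi)] at this
      simpa using this
  · rintro ⟨hle, h0⟩
    refine ⟨(Finset.univ.filter fun i => ‖y i‖ = 1)ᶜ, by rwa [compl_compl], fun i => ?_⟩
    split_ifs with hi
    · simpa using hle i
    · simpa using hi

theorem norm_leafMap_apply {r : ℝ} (hr : 0 < r) (T : EuclideanSpace ℝ (Fin d)) (i : Fin m) :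
    ‖leafMap A z T r i‖ = r * (‖z i‖ * Real.exp (inner ℝ (A i) T)) := by
  simp only [leafMap, norm_mul, Complex.norm_real, Real.norm_eq_abs, abs_of_pos hr, Real.abs_exp]

/-! ### Uniqueness -/

theorem IsAdmissible.eq_of_leafMap_mem_of_le (hA : IsAdmissible A) {r s : ℝ} (hr : 0 < r)
    (hrs : r ≤ s) {T T' : EuclideanSpace ℝ (Fin d)}
    (h : leafMap A z T r ∈ momentAngleComplex (simplicialComplex A))
    (h' : leafMap A z T' s ∈ momentAngleComplex (simplicialComplex A)) : r = s ∧ T = T' := by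
  have hs := hr.trans_le hrs
  obtain ⟨-, h0⟩ := mem_momentAngleComplex_iff.1 h
  obtain ⟨hle, -⟩ := mem_momentAngleComplex_iff.1 h'
  simp only [norm_leafMap_apply hr] at h0
  simp only [norm_leafMap_apply hs] at hle
  have hz : ∀ i, r * (‖z i‖ * Real.exp (inner ℝ (A i) T)) = 1 → 0 < ‖z i‖ := by
    intro i hi
    refine (norm_nonneg _).lt_of_ne fun h => ?_
    simp [← h] at hi
  have hT : T' - T = 0 := by
    refine hA.eq_zero_of_inner_nonpos h0 fun i hi => ?_
    replace hi : r * (‖z i‖ * Real.exp (inner ℝ (A i) T)) = 1 := by simpa using hi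
    have hzi := hz i hi
    rw [inner_sub_right, sub_nonpos]
    by_contra! hlt
    have : r * (‖z i‖ * Real.exp (inner ℝ (A i) T)) < s * (‖z i‖ * Real.exp (inner ℝ (A i) T')) :=
      mul_lt_mul' hrs (by gcongr) (by positivity) hs
    linarith [hle i]
  obtain rfl : T' = T := sub_eq_zero.1 hT
  obtain ⟨i, hi⟩ := nonempty_of_zero_mem_convSub h0
  replace hi : r * (‖z i‖ * Real.exp (inner ℝ (A i) T')) = 1 := by simpa using hi
  have hzi := hz i hi
  refine ⟨hrs.antisymm ?_, rfl⟩
  exact le_of_mul_le_mul_right ((hle i).trans hi.ge) (by positivity)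

/-! ### Existence -/

/-- The function `T ↦ max_i ‖z i‖ exp ⟪A i, T⟫` attains its minimum. The maximum is written as the
sup norm of `leafMap A z T 1`. -/
theorem IsAdmissible.exists_forall_norm_leafMap_le (hA : IsAdmissible A) (hz : z ∈ siegelSet A) :
    ∃ T, ∀ T', ‖leafMap A z T 1‖ ≤ ‖leafMap A z T' 1‖ := by
  have hcont : Continuous fun T => ‖leafMap A z T 1‖ := by
    unfold leafMap
    fun_prop
  refine hcont.exists_forall_le ?_
  have hI : 0 ∈ convSub A (nonzeroIndices z) := hz
  obtain ⟨ε, hε, hbound⟩ := hA.exists_mul_norm_le_inner hI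
  obtain ⟨k, hk, hmin⟩ := (nonzeroIndices z).exists_min_image (fun i => ‖z i‖)
    (nonempty_of_zero_mem_convSub hI)
  have hzk : 0 < ‖z k‖ := by simpa [nonzeroIndices] using hk
  have hlim : Tendsto (fun T : EuclideanSpace ℝ (Fin d) => ‖z k‖ * Real.exp (ε * ‖T‖))
      (cocompact _) atTop :=
    (Real.tendsto_exp_atTop.comp
      ((tendsto_norm_cocompact_atTop).const_mul_atTop hε)).const_mul_atTop hzk
  refine tendsto_atTop_mono (fun T => ?_) hlim
  obtain ⟨i, hi, hle⟩ := hbound T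
  calc ‖z k‖ * Real.exp (ε * ‖T‖) ≤ ‖z i‖ * Real.exp (inner ℝ (A i) T) := by
        gcongr
        exact hmin i hi
    _ = ‖leafMap A z T 1 i‖ := by rw [norm_leafMap_apply one_pos, one_mul]
    _ ≤ ‖leafMap A z T 1‖ := norm_le_pi_norm _ i

/-- First-order optimality: at a minimum of `T ↦ max_i ‖z i‖ exp ⟪A i, T⟫`, the origin is in the
convex hull of the `A i` for which the maximum is attained. -/
theorem zero_mem_convSub_of_forall_norm_leafMap_le {T : EuclideanSpace ℝ (Fin d)}
    (hpos : 0 < ‖leafMap A z T 1‖) (hT : ∀ T', ‖leafMap A z T 1‖ ≤ ‖leafMap A z T' 1‖) :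
    0 ∈ convSub A (Finset.univ.filter fun i => ‖leafMap A z T 1 i‖ = ‖leafMap A z T 1‖) := by
  set M := ‖leafMap A z T 1‖ with hM
  by_contra h0
  have hclosed : IsClosed (convSub A (Finset.univ.filter fun i => ‖leafMap A z T 1 i‖ = M)) :=
    ((Finset.finite_toSet _).image A).isClosed_convexHull ℝ
  obtain ⟨f, u, hfu, hf0⟩ := geometric_hahn_banach_closed_point (convex_convexHull ℝ _) hclosed h0
  rw [map_zero] at hf0
  obtain ⟨v, rfl⟩ := (InnerProductSpace.toDual ℝ (EuclideanSpace ℝ (Fin d))).surjective f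
  have hv : ∀ i, ‖leafMap A z T 1 i‖ = M → inner ℝ (A i) v < 0 := by
    intro i hi
    rw [real_inner_comm]
    exact (hfu (A i) (subset_convexHull ℝ _ ⟨i, by simpa using hi, rfl⟩)).trans hf0
  -- For small `t > 0` every entry at `T + t • v` is below `M`: the active ones decrease along `v`,
  -- the others are below `M` at `T` already.
  have hdec : ∀ᶠ t : ℝ in 𝓝[>] 0, ∀ i, ‖leafMap A z (T + t • v) 1 i‖ < M := by
    refine eventually_all.2 fun i => ?_
    rcases (norm_le_pi_norm (leafMap A z T 1) i).eq_or_lt with hi | hi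
    · filter_upwards [self_mem_nhdsWithin] with t ht
      have hzi : 0 < ‖z i‖ := by
        refine (norm_nonneg _).lt_of_ne fun h => ?_
        rw [norm_leafMap_apply one_pos, ← h, ← hM] at hi
        simp only [zero_mul, mul_zero] at hi
        exact hpos.ne hi
      rw [hM, ← hi, norm_leafMap_apply one_pos, norm_leafMap_apply one_pos, one_mul, one_mul]
      have : t * inner ℝ (A i) v < 0 := mul_neg_of_pos_of_neg ht (hv i hi)
      gcongr
      rw [inner_add_right, real_inner_smul_right]
      linarith
    · have hcont : Continuous fun t : ℝ => ‖leafMap A z (T + t • v) 1 i‖ := by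
        unfold leafMap
        fun_prop
      have hlim := hcont.tendsto 0
      rw [zero_smul, add_zero] at hlim
      exact (hlim.eventually_lt_const hi).filter_mono nhdsWithin_le_nhds
  obtain ⟨t, ht⟩ := hdec.exists
  exact ((pi_norm_lt_iff hpos).2 ht).not_ge (hT _)

theorem IsAdmissible.exists_leafMap_mem (hA : IsAdmissible A) (hz : z ∈ siegelSet A) :
    ∃ r : ℝ, 0 < r ∧ ∃ T, leafMap A z T r ∈ momentAngleComplex (simplicialComplex A) := by
  obtain ⟨T, hT⟩ := hA.exists_forall_norm_leafMap_le hz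
  have hpos : 0 < ‖leafMap A z T 1‖ := by
    obtain ⟨i, hi⟩ := nonempty_of_zero_mem_convSub (A := A) (I := nonzeroIndices z) hz
    have hzi : 0 < ‖z i‖ := by simpa [nonzeroIndices] using hi
    refine lt_of_lt_of_le ?_ (norm_le_pi_norm _ i)
    rw [norm_leafMap_apply one_pos]
    positivity
  have hr : 0 < ‖leafMap A z T 1‖⁻¹ := inv_pos.2 hpos
  have hscale : ∀ i, ‖leafMap A z T ‖leafMap A z T 1‖⁻¹ i‖ =
      ‖leafMap A z T 1 i‖ / ‖leafMap A z T 1‖ := fun i => by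
    rw [norm_leafMap_apply hr, norm_leafMap_apply one_pos, one_mul, inv_mul_eq_div]
  refine ⟨_, hr, T, mem_momentAngleComplex_iff.2 ⟨fun i => ?_, ?_⟩⟩
  · rw [hscale]
    exact div_le_one_of_le₀ (norm_le_pi_norm _ i) hpos.le
  · simpa only [hscale, div_eq_one_iff_eq hpos.ne'] using
      zero_mem_convSub_of_forall_norm_leafMap_le hpos hT

end SiegelLeaf

theorem mainTheorem6 {m d : ℕ} (hmd : d < m) (A : Fin m → EuclideanSpace ℝ (Fin d))
    (hA : SiegelLeaf.IsAdmissible A) (hc : SiegelLeaf.IsCentered A)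
    (z : Fin m → ℂ) (hz : z ∈ SiegelLeaf.siegelSet A) :
    ∃! p : ℝ × EuclideanSpace ℝ (Fin d),
      0 < p.1 ∧ SiegelLeaf.leafMap A z p.2 p.1 ∈
        SiegelLeaf.momentAngleComplex (SiegelLeaf.simplicialComplex A) := by
  obtain ⟨r, hr, T, hT⟩ := hA.exists_leafMap_mem hz
  refine ⟨(r, T), ⟨hr, hT⟩, ?_⟩
  rintro ⟨s, T'⟩ ⟨hs, hT'⟩
  rcases le_total s r with h | h
  · obtain ⟨h₁, h₂⟩ := hA.eq_of_leafMap_mem_of_le hs h hT' hT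
    exact Prod.ext h₁ h₂
  · obtain ⟨h₁, h₂⟩ := hA.eq_of_leafMap_mem_of_le hr h hT hT'
    exact Prod.ext h₁.symm h₂.symm
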